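/- Let $(\mathbb S,d)$ be a complete separable metric space with Borel $\sigma$-algebra $\mathcal S$, let $\mathbb C\subset\mathbb S$ be closed and $\mathbb O=\mathbb S\setminus\mathbb C$, and let $\mathcal S_{\mathbb O}=\{A\in\mathcal S: A\subset\mathbb O\}$. For $r>0$ put $\mathbb C^r=\{x\in\mathbb S: d(x,\mathbb C)<r\}$ (with $d(x,\emptyset)=\infty$); a set $A\in\mathcal S_{\mathbb O}$ is bounded away from $\mathbb C$ if $A\subset\mathbb S\setminus\mathbb C^r$ for some $r>0$. Let $\mathcal C_{\mathbb O}$ be the set of non-negative bounded continuous functions $f:\mathbb O\to\mathbb R$ that vanish on $\mathbb O\cap\mathbb C^r$ for some $r>0$. Let $\mathbb M_{\mathbb O}$ be the set of measures $\mu$ on $(\mathbb O,\mathcal S_{\mathbb O})$ with $\mu(\mathbb S\setminus\mathbb C^r)<\infty$ for all $r>0$, equipped with the $\sigma$-algebra $\mathcal M_{\mathbb O}$ generated by the sets $$\Big\{\upsilon\in\mathbb M_{\mathbb O}:\Big|\int f_i\,d\upsilon-\int f_i\,d\mu\Big|<\varepsilon,\ i=1,\dots,k\Big\},\qquad \mu\in\mathbb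 M_{\mathbb O},\ \varepsilon>0,\ k\in\mathbb N,\ f_1,\dots,f_k\in\mathcal C_{\mathbb O}.$$ Let $\mathbb N_{\mathbb O}$ be the set of those $N\in\mathbb M_{\mathbb O}$ for which $N(A\setminus\mathbb C^r)$ is a non-negative integer for all $A\in\mathcal S$ and $r>0$, equipped with the trace $\mathcal N_{\mathbb O}$ of $\mathcal M_{\mathbb O}$. A random measure (respectively, a point process) is a measurable map from a probability space into $(\mathbb M_{\mathbb O},\mathcal M_{\mathbb O})$ (respectively, into $(\mathbb N_{\mathbb O},\mathcal N_{\mathbb O})$). Let $\mathcal D$ be a $\pi$-system of Borel sets bounded away from $\mathbb C$ which covers $\mathbb O$, that is $\bigcup_{A\in\mathcal D}A=\mathbb O$, and which generates $\mathcal S_{\mathbb O}$ as a $\sigma$-algebra on $\mathbb O$. Let $(\Omega,\mathcal E,P)$ be a probability space. (i) A map $\xi:\Omega\to\mathbb M_{\mathbb O}$ is a random measure if and only if $\omega\mapsto\xi(\omega)(A)$ is a random variable (a measurable function into $[0,\infty]$) for every $A\in\mathcal D$. (ii) A map $N:\Omega\to\mathbb N_{\mathbb O}$ is a point process if and only if $\omega\mapsto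 N(\omega)(A)$ is a random variable for every $A\in\mathcal D$. -/

import Mathlib

open MeasureTheory Set
open scoped BoundedContinuousFunction

namespace RandMeas

variable {S : Type*} [MetricSpace S] [MeasurableSpace S]

/-- The part of `𝕆 = S \ C` outside `C^r = {x | d(x, C) < r}` (with `d(x, ∅) = ∞`). Measurable
sets of the subtype `↥Cᶜ` are exactly the Borel sets of `S` contained in `𝕆`. -/
def outer (C : Set S) (r : ℝ) : Set ↥Cᶜ :=
  {x | (x : S) ∉ Metric.thickening r C}

/-- `A ⊆ S \ C^r` for some `r > 0`. -/
def IsBoundedAway (C : Set S) (A : Set ↥Cᶜ) : Prop :=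
  ∃ r : ℝ, 0 < r ∧ A ⊆ outer C r

/-- The class `𝒞_𝕆`: non-negative bounded continuous real functions on `𝕆` that vanish on `C^r`
for some `r > 0`. -/
def testFunctions (C : Set S) : Set (↥Cᶜ →ᵇ ℝ) :=
  {f | (∀ x, 0 ≤ f x) ∧ ∃ r : ℝ, 0 < r ∧ ∀ x : ↥Cᶜ, (x : S) ∈ Metric.thickening r C → f x = 0}

/-- The space `𝕄_𝕆` of Borel measures on `𝕆` that are finite on `S \ C^r` for every `r > 0`. -/
structure MO (C : Set S) where
  /-- The underlying measure. -/
  toMeasure : Measure ↥Cᶜ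
  finite_outer : ∀ r : ℝ, 0 < r → toMeasure (outer C r) < ⊤

/-- The neighbourhood `{υ | |∫ f i dυ - ∫ f i dμ| < ε for all i}` of `μ`. -/
def basicNhd {C : Set S} (μ : MO C) (ε : ℝ) {k : ℕ} (f : Fin k → (↥Cᶜ →ᵇ ℝ)) : Set (MO C) :=
  {υ | ∀ i, |(∫ x, f i x ∂υ.toMeasure) - ∫ x, f i x ∂μ.toMeasure| < ε}

/-- The σ-algebra on `𝕄_𝕆` generated by the basic neighbourhoods. -/
instance instMeasurableSpaceMO (C : Set S) : MeasurableSpace (MO C) :=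
  MeasurableSpace.generateFrom
    {U | ∃ (μ : MO C) (ε : ℝ) (k : ℕ) (f : Fin k → (↥Cᶜ →ᵇ ℝ)),
      0 < ε ∧ (∀ i, f i ∈ testFunctions C) ∧ U = basicNhd μ ε f}

/-- The space `ℕ_𝕆` of counting measures: `μ (A \ C^r)` is a non-negative integer for all `r > 0`
and all Borel sets `A` of `S`. -/
structure NO (C : Set S) where
  /-- The underlying element of `𝕄_𝕆`. -/
  toMO : MO C
  isCounting : ∀ r : ℝ, 0 < r → ∀ A : Set S, MeasurableSet A →
    ∃ n : ℕ, toMO.toMeasure (Subtype.val ⁻¹' A ∩ outer C r) = n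

/-- The trace on `ℕ_𝕆` of the σ-algebra of `𝕄_𝕆`. -/
instance instMeasurableSpaceNO (C : Set S) : MeasurableSpace (NO C) :=
  MeasurableSpace.comap NO.toMO inferInstance

/-- `ξ : Ω → 𝕄_𝕆` is a random measure on the probability space `(Ω, P)`. -/
def IsRandomMeasure {C : Set S} {Ω : Type*} [MeasurableSpace Ω]
    (_P : Measure Ω) [IsProbabilityMeasure _P] (ξ : Ω → MO C) : Prop :=
  Measurable ξ

/-- `N : Ω → ℕ_𝕆` is a point process on the probability space `(Ω, P)`. -/
def IsPointProcess {C : Set S} {Ω : Type*} [MeasurableSpace Ω]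
    (_P : Measure Ω) [IsProbabilityMeasure _P] (N : Ω → NO C) : Prop :=
  Measurable N

end RandMeas

open Filter Topology

/-! Thickened indicators approximate indicators of closed sets bounded away from `C`, so their
masses are measurable on `MO C`; a π-λ argument extends this to all Borel sets bounded away from
`C`. Conversely, integrals of test functions are measurable in the measure. For `D`, π-λ applies to
the restriction to each member, which is finite. Gluing the restrictions needs a countable subcover:
a countable separating family, each of whose sets is countably covered by `D` or has such a
complement, leaves at most one point uncovered. -/

/-- A set generated by `D` has the property that it, or its complement, is covered by countably
many members of `D`. -/
theorem exists_countable_cover_or_compl {α : Type*} {D : Set (Set α)} {s : Set α}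
    (hs : MeasurableSet[MeasurableSpace.generateFrom D] s) :
    (∃ T ⊆ D, T.Countable ∧ s ⊆ ⋃₀ T) ∨ ∃ T ⊆ D, T.Countable ∧ sᶜ ⊆ ⋃₀ T := by
  induction s, hs using MeasurableSpace.generateFrom_induction with
  | hC t ht =>
    exact Or.inl ⟨{t}, by simpa using ht, countable_singleton t, by simp⟩
  | empty => exact Or.inl ⟨∅, by simp, countable_empty, by simp⟩
  | compl t _ ih => rwa [compl_compl, or_comm]
  | iUnion f _ ih =>
    by_cases h : ∀ n, ∃ T ⊆ D, T.Countable ∧ f n ⊆ ⋃₀ T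
    · choose T hTD hTc hT using h
      refine Or.inl ⟨⋃ n, T n, iUnion_subset hTD, countable_iUnion hTc, iUnion_subset fun n => ?_⟩
      exact (hT n).trans (sUnion_subset_sUnion (subset_iUnion T n))
    · push Not at h
      obtain ⟨n, hn⟩ := h
      obtain ⟨T, hTD, hTc, hT⟩ := (ih n).resolve_left fun ⟨T, h1, h2, h3⟩ => hn T h1 h2 h3
      exact Or.inr ⟨T, hTD, hTc, (compl_subset_compl.2 (subset_iUnion f n)).trans hT⟩

/-- A cover which generates a countably separated σ-algebra has a countable subcover. -/
theorem exists_countable_subcover_of_generateFrom {α : Type*} [m : MeasurableSpace α]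
    [MeasurableSpace.CountablySeparated α] {D : Set (Set α)}
    (hgen : MeasurableSpace.generateFrom D = m) (hcover : ⋃₀ D = univ) :
    ∃ T ⊆ D, T.Countable ∧ ⋃₀ T = univ := by
  obtain ⟨e, he, hsep⟩ := exists_seq_separating α (p := MeasurableSet) MeasurableSet.empty univ
  have key : ∀ n, ∃ T ⊆ D, T.Countable ∧ (e n ⊆ ⋃₀ T ∨ (e n)ᶜ ⊆ ⋃₀ T) := fun n => by
    have hn : MeasurableSet[MeasurableSpace.generateFrom D] (e n) := hgen ▸ he n
    rcases exists_countable_cover_or_compl hn with ⟨T, h1, h2, h3⟩ | ⟨T, h1, h2, h3⟩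
    exacts [⟨T, h1, h2, Or.inl h3⟩, ⟨T, h1, h2, Or.inr h3⟩]
  choose T hTD hTc hT using key
  -- Uncovered points all lie outside `e n`, or all inside it, according to which side `T n` covers;
  -- so no `e n` separates two of them.
  have hrest : (⋃₀ ⋃ n, T n)ᶜ.Subsingleton := by
    intro x hx y hy
    have hmem : ∀ z ∈ (⋃₀ ⋃ n, T n)ᶜ, ∀ n, z ∉ ⋃₀ T n := fun z hz n h =>
      hz (sUnion_subset_sUnion (subset_iUnion T n) h)
    refine hsep x trivial y trivial fun n => ?_
    rcases hT n with h | h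
    · exact iff_of_false (fun h' => hmem x hx n (h h')) fun h' => hmem y hy n (h h')
    · exact iff_of_true (not_not.1 fun h' => hmem x hx n (h h'))
        (not_not.1 fun h' => hmem y hy n (h h'))
  rcases hrest.eq_empty_or_singleton with h | ⟨x, hx⟩
  · exact ⟨⋃ n, T n, iUnion_subset hTD, countable_iUnion hTc, compl_empty_iff.1 h⟩
  · obtain ⟨A, hA, hxA⟩ : x ∈ ⋃₀ D := hcover ▸ mem_univ x
    refine ⟨insert A (⋃ n, T n), insert_subset hA (iUnion_subset hTD),
      (countable_iUnion hTc).insert A, eq_univ_of_forall fun y => ?_⟩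
    rw [sUnion_insert]
    by_cases hy : y ∈ ⋃₀ ⋃ n, T n
    · exact Or.inr hy
    · have : y ∈ ({x} : Set α) := hx ▸ hy
      exact Or.inl (mem_singleton_iff.1 this ▸ hxA)

/-- A family of measures is measurable as soon as its values are measurable on a generating
π-system of sets of finite measure that contains a countable cover. -/
theorem measurable_measure_of_isPiSystem_of_cover {α Ω : Type*} [m : MeasurableSpace α]
    [MeasurableSpace Ω] {D T : Set (Set α)} (hpi : IsPiSystem D)
    (hgen : MeasurableSpace.generateFrom D = m) (hTD : T ⊆ D) (hTc : T.Countable)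
    (hT : ⋃₀ T = univ) {μ : Ω → Measure α} (hfin : ∀ ω, ∀ A ∈ D, μ ω A < ⊤)
    (hμ : ∀ A ∈ D, Measurable fun ω => μ ω A) : Measurable μ := by
  have hDm : ∀ A ∈ D, MeasurableSet A := fun A hA =>
    hgen ▸ MeasurableSpace.measurableSet_generateFrom hA
  -- Adding `∅` makes the family nonempty, so that a sequence can enumerate it.
  have hrestr : ∀ A ∈ insert ∅ T, Measurable fun ω => (μ ω).restrict A := by
    rintro A (rfl | hA)
    · simp
    have hAD := hTD hA
    have : ∀ ω, IsFiniteMeasure ((μ ω).restrict A) := fun ω =>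
      ⟨by simpa using hfin ω A hAD⟩
    refine Measurable.measure_of_isPiSystem hgen.symm hpi (fun B hB => ?_) ?_
    · simp_rw [Measure.restrict_apply (hDm B hB)]
      rcases (B ∩ A).eq_empty_or_nonempty with h | h
      · simp [h]
      · exact hμ _ (hpi B hB A hAD h)
    · simpa using hμ A hAD
  obtain ⟨A, hA⟩ := (hTc.insert ∅).exists_eq_range (insert_nonempty ∅ T)
  have hAT : ∀ n, A n ∈ insert ∅ T := fun n => hA ▸ mem_range_self n
  have hAm : ∀ n, MeasurableSet (A n) := fun n => by
    rcases hAT n with h | h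
    · exact h ▸ MeasurableSet.empty
    · exact hDm _ (hTD h)
  have hAU : ⋃ n, A n = univ := by rw [← sUnion_range, ← hA, sUnion_insert, hT, union_univ]
  refine Measure.measurable_of_measurable_coe _ fun B hB => ?_
  have hm : ∀ n, MeasurableSet (disjointed A n ∩ B) := fun n =>
    (MeasurableSet.disjointed hAm n).inter hB
  have hsum : ∀ ω, μ ω B = ∑' n, (μ ω).restrict (A n) (disjointed A n ∩ B) := fun ω => by
    have hB' : B = ⋃ n, disjointed A n ∩ B := by
      rw [← iUnion_inter, iUnion_disjointed, hAU, univ_inter]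
    conv_lhs => rw [hB', measure_iUnion (fun i j hij =>
      ((disjoint_disjointed A) hij).mono inter_subset_left inter_subset_left) hm]
    refine tsum_congr fun n => ?_
    rw [Measure.restrict_apply (hm n), inter_eq_left.2
      (inter_subset_left.trans (disjointed_subset A n))]
  simp_rw [hsum]
  exact Measurable.tsum fun n => (Measure.measurable_coe (hm n)).comp (hrestr _ (hAT n))

namespace RandMeas

variable {S : Type*} [MetricSpace S] {C : Set S}

theorem outer_anti {r s : ℝ} (h : r ≤ s) : outer C s ⊆ outer C r :=
  fun _ hx hx' => hx (Metric.thickening_mono h C hx')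

theorem isClosed_outer (r : ℝ) : IsClosed (outer C r) :=
  (Metric.isOpen_thickening.preimage continuous_subtype_val).isClosed_compl

variable [MeasurableSpace S]

/-- Integration of a test function is measurable on `𝕄_𝕆`. -/
theorem measurable_integral_testFunction {f : ↥Cᶜ →ᵇ ℝ} (hf : f ∈ testFunctions C) :
    Measurable fun μ : MO C => ∫ x, f x ∂μ.toMeasure := by
  refine measurable_of_Iio fun a => ?_
  have hnn : ∀ μ : MO C, 0 ≤ ∫ x, f x ∂μ.toMeasure := fun μ => integral_nonneg hf.1
  rcases le_or_gt a 0 with ha | ha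
  · convert MeasurableSet.empty
    exact eq_empty_of_forall_notMem fun μ hμ => (lt_of_lt_of_le hμ ha).not_ge (hnn μ)
  -- For `a > 0` the sublevel set is the basic neighbourhood of the zero measure with radius `a`.
  · refine MeasurableSpace.measurableSet_generateFrom
      ⟨⟨0, fun r _ => by simp⟩, a, 1, fun _ => f, ha, fun _ => hf, ?_⟩
    ext μ
    simp [basicNhd, abs_of_nonneg (hnn μ)]

section Borel

variable [BorelSpace S]

/-- The mass of a closed set bounded away from `C` is measurable on `𝕄_𝕆`. -/
theorem measurable_toMeasure_of_isClosed {F : Set ↥Cᶜ} (hF : IsClosed F) {r : ℝ} (hr : 0 < r)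
    (hFr : F ⊆ outer C r) : Measurable fun μ : MO C => μ.toMeasure F := by
  -- Half of the gap `r` bounds the thickening of `F`; the other half is where the approximants
  -- vanish near `C`.
  have hr2 : 0 < r / 2 := half_pos hr
  set δ : ℕ → ℝ := fun n => r / 2 / (n + 1) with hδ
  have hδpos : ∀ n, 0 < δ n := fun n => by positivity
  have hδle : ∀ n, δ n ≤ r / 2 := fun n => div_le_self hr2.le (by simp)
  have hδlim : Tendsto δ atTop (𝓝 0) := tendsto_const_div_atTop_nhds_zero_nat (r / 2) |>.comp
    (tendsto_add_atTop_nat 1) |>.congr fun n => by simp [hδ]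
  have hzero : ∀ n, ∀ x : ↥Cᶜ, (x : S) ∈ Metric.thickening (r / 2) C →
      thickenedIndicator (hδpos n) F x = 0 := fun n x hx => by
    refine thickenedIndicator_zero _ _ fun hxF => ?_
    obtain ⟨c, hc, hxc⟩ := Metric.mem_thickening_iff.1 hx
    obtain ⟨y, hy, hxy⟩ := Metric.mem_thickening_iff.1 hxF
    refine hFr hy (Metric.mem_thickening_iff.2 ⟨c, hc, ?_⟩)
    have h1 : dist (x : S) y < r / 2 := hxy.trans_le (hδle n)
    linarith [dist_triangle_left (y : S) c x]
  let g : ℕ → (↥Cᶜ →ᵇ ℝ) := fun n =>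
    BoundedContinuousFunction.ofNormedAddCommGroup
      (fun x => (thickenedIndicator (hδpos n) F x : ℝ)) (by fun_prop) 1 fun x => by
        simpa using thickenedIndicator_le_one (hδpos n) F x
  have hg : ∀ n, g n ∈ testFunctions C := fun n =>
    ⟨fun x => NNReal.coe_nonneg _, r / 2, hr2, fun x hx => NNReal.coe_eq_zero.2 (hzero n x hx)⟩
  have hreal : Measurable fun μ : MO C => μ.toMeasure.real F := by
    refine measurable_of_tendsto_metrizable
      (fun n => measurable_integral_testFunction (hg n)) (tendsto_pi_nhds.2 fun μ => ?_)
    -- `μ` may be infinite. The restriction is finite and leaves the integrals unchanged, since the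
    -- approximants vanish off `outer C (r / 2)`.
    have : IsFiniteMeasure (μ.toMeasure.restrict (outer C (r / 2))) :=
      ⟨by simpa using μ.finite_outer _ hr2⟩
    have h := tendsto_integral_thickenedIndicator_of_isClosed
      (μ.toMeasure.restrict (outer C (r / 2))) hF hδpos hδlim
    rw [measureReal_restrict_apply hF.measurableSet,
      inter_eq_left.2 (hFr.trans (outer_anti (half_le_self hr.le)))] at h
    refine h.congr fun n => setIntegral_eq_integral_of_forall_compl_eq_zero fun x hx => ?_
    exact NNReal.coe_eq_zero.2 (hzero n x (not_not.1 hx))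
  have heq : (fun μ : MO C => μ.toMeasure F) = fun μ => ENNReal.ofReal (μ.toMeasure.real F) :=
    funext fun μ => (ofReal_measureReal
      ((measure_mono hFr).trans_lt (μ.finite_outer r hr)).ne).symm
  exact heq ▸ hreal.ennreal_ofReal

/-- The mass of a Borel set bounded away from `C` is measurable on `𝕄_𝕆`. -/
theorem measurable_toMeasure_of_isBoundedAway {A : Set ↥Cᶜ} (hA : MeasurableSet A)
    (hAC : IsBoundedAway C A) : Measurable fun μ : MO C => μ.toMeasure A := by
  obtain ⟨r, hr, hAr⟩ := hAC
  have hfin : ∀ μ : MO C, IsFiniteMeasure (μ.toMeasure.restrict (outer C r)) := fun μ =>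
    ⟨by simpa using μ.finite_outer r hr⟩
  have h : Measurable fun μ : MO C => μ.toMeasure.restrict (outer C r) := by
    refine Measurable.measure_of_isPiSystem
      (BorelSpace.measurable_eq.trans borel_eq_generateFrom_isClosed) isPiSystem_isClosed
      (fun F hF => ?_) ?_
    · simp_rw [Measure.restrict_apply (IsClosed.measurableSet hF)]
      exact measurable_toMeasure_of_isClosed (IsClosed.inter hF (isClosed_outer r)) hr
        inter_subset_right
    · simpa using measurable_toMeasure_of_isClosed (isClosed_outer r) hr Subset.rfl
  simpa [Function.comp_def, Measure.restrict_apply hA, inter_eq_left.2 hAr] using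
    (Measure.measurable_coe hA).comp h

/-- A map into `𝕄_𝕆` is measurable if it is measurable as a map into the measures on `𝕆`. -/
theorem measurable_of_measurable_toMeasure {Ω : Type*} [MeasurableSpace Ω] {ξ : Ω → MO C}
    (h : Measurable fun ω => (ξ ω).toMeasure) : Measurable ξ := by
  refine measurable_generateFrom ?_
  rintro _ ⟨μ, ε, k, f, -, hf, rfl⟩
  have hint : ∀ i, Measurable fun ω => ∫ x, f i x ∂(ξ ω).toMeasure := fun i => by
    simp_rw [fun ω => integral_eq_lintegral_of_nonneg_ae (μ := (ξ ω).toMeasure)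
      (Eventually.of_forall (hf i).1) (f i).continuous.aestronglyMeasurable]
    exact ((Measure.measurable_lintegral
      (f i).continuous.measurable.ennreal_ofReal).comp h).ennreal_toReal
  have : ξ ⁻¹' basicNhd μ ε f = ⋂ i, {ω | |(∫ x, f i x ∂(ξ ω).toMeasure) -
      ∫ x, f i x ∂μ.toMeasure| < ε} := by
    ext ω; simp [basicNhd]
  rw [this]
  refine MeasurableSet.iInter fun i => measurableSet_lt ?_ measurable_const
  exact continuous_abs.measurable.comp ((hint i).sub_const _)

end Borel

theorem measurable_iff_of_isPiSystem [BorelSpace S] [TopologicalSpace.SeparableSpace S]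
    {D : Set (Set ↥Cᶜ)} (hD_pi : IsPiSystem D)
    (hD_meas : ∀ A ∈ D, MeasurableSet A) (hD_away : ∀ A ∈ D, IsBoundedAway C A)
    (hD_gen : MeasurableSpace.generateFrom D = (inferInstance : MeasurableSpace ↥Cᶜ))
    (hD_cover : ⋃₀ D = univ) {Ω : Type*} [MeasurableSpace Ω] (ξ : Ω → MO C) :
    Measurable ξ ↔ ∀ A ∈ D, Measurable fun ω => (ξ ω).toMeasure A := by
  refine ⟨fun h A hA =>
    (measurable_toMeasure_of_isBoundedAway (hD_meas A hA) (hD_away A hA)).comp h, fun h => ?_⟩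
  have : SecondCountableTopology S := UniformSpace.secondCountable_of_separable S
  obtain ⟨T, hTD, hTc, hT⟩ := exists_countable_subcover_of_generateFrom hD_gen hD_cover
  refine measurable_of_measurable_toMeasure
    (measurable_measure_of_isPiSystem_of_cover hD_pi hD_gen hTD hTc hT (fun ω A hA => ?_) h)
  obtain ⟨r, hr, hAr⟩ := hD_away A hA
  exact (measure_mono hAr).trans_lt ((ξ ω).finite_outer r hr)

end RandMeas

theorem theorem3p1 {S : Type*} [MetricSpace S] [CompleteSpace S]
    [TopologicalSpace.SeparableSpace S] [MeasurableSpace S] [BorelSpace S]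
    (C : Set S) (hC : IsClosed C)
    (D : Set (Set ↥Cᶜ)) (hD_pi : IsPiSystem D)
    (hD_meas : ∀ A ∈ D, MeasurableSet A) (hD_away : ∀ A ∈ D, RandMeas.IsBoundedAway C A)
    (hD_gen : MeasurableSpace.generateFrom D = (inferInstance : MeasurableSpace ↥Cᶜ))
    (hD_cover : ⋃₀ D = Set.univ)
    {Ω : Type*} [MeasurableSpace Ω] (P : MeasureTheory.Measure Ω)
    [MeasureTheory.IsProbabilityMeasure P] :
    (∀ ξ : Ω → RandMeas.MO C,
      RandMeas.IsRandomMeasure P ξ ↔ ∀ A ∈ D, Measurable fun ω => (ξ ω).toMeasure A) ∧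
    (∀ N : Ω → RandMeas.NO C,
      RandMeas.IsPointProcess P N ↔ ∀ A ∈ D, Measurable fun ω => (N ω).toMO.toMeasure A) := by
  have key := fun ξ : Ω → RandMeas.MO C =>
    RandMeas.measurable_iff_of_isPiSystem hD_pi hD_meas hD_away hD_gen hD_cover ξ
  -- Measurability into a trace σ-algebra is measurability after inclusion, so (ii) reduces to (i).
  exact ⟨key, fun N => measurable_comap_iff.trans (key fun ω => (N ω).toMO)⟩
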